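/- For an integer $n\ge 1$ let $(E)_n$ denote the Diophantine equation $\frac1{x_1}+\dots+\frac1{x_n}=1$ in pairwise distinct positive integers; solutions are counted as sets $\{x_1,\dots,x_n\}$, that is, up to order. For an odd prime $q$ let $\mathcal S_q(n)$ be the set of solutions of $(E)_n$ in which every $x_i$ has the form $2^{\alpha}q^{\beta}$ with integers $0\le\alpha\le 2$ and $\beta\ge 0$, and let $\mathcal S(n)=\bigcup_q \mathcal S_q(n)$, the union being over all odd primes $q$ (so $q$ is the same for all members of a solution, but may vary with the solution). Consider the following system for nine integer sequences $(tri,sq,ast,dia,St_1,St_2,St,t,p)$ indexed by $n\ge 3$, where $\delta_{n=k}$ is $1$ if $n=k$ and $0$ otherwise: $$\begin{aligned} ast(n)&=ast(n-1)+dia(n-1)+\delta_{n=4} &&(n\ge4)\\ tri(n)&=tri(n-1)+sq(n-1)+St_1(n-1)+St_2(n-1)+St(n-1) &&(n\ge4)\\ sq(n)&=ast(n-1)+dia(n-1) &&(n\ge4)\\ dia(n)&=tri(n-2)+sq(n-2)+St_1(n-2)+St_2(n-2)+St(n-2) &&(n\ge5)\\ St_1(n)&=ast(n-3)+dia(n-3)+\delta_{n=6}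 &&(n\ge6)\\ St_2(n)&=ast(n-5)+dia(n-5)+t(n-5)+p(n-5)+\delta_{n=8} &&(n\ge8)\\ St(n)&=tri(n-5)+sq(n-5)+St_1(n-5)+St_2(n-5)+St(n-5) &&(n\ge8)\\ t(n)&=ast(n-2)+dia(n-2)+t(n-2)+p(n-2)+\delta_{n=5} &&(n\ge5)\\ p(n)&=tri(n-2)+sq(n-2)+St_1(n-2)+St_2(n-2)+St(n-2) &&(n\ge5) \end{aligned}$$ with initial conditions $tri(3)=1$; $sq(3)=ast(3)=0$; $dia(k)=t(k)=p(k)=0$ for $k=3,4$; $St_1(k)=0$ for $3\le k\le5$; $St_2(k)=St(k)=0$ for $3\le k\le 7$. Then this system has exactly one solution. Put $\Sigma(n)=tri(n)+sq(n)+ast(n)+dia(n)+St_1(n)+St_2(n)+St(n)$. For every $n\ge 9$: 1. $\mathcal S_3(n)$ is finite and $|\mathcal S_3(n)|=\Sigma(n)$. 2. $\mathcal S_5(n)=\{U_n\}$ with $U_n=\{2,2^2,5,5^2,\dots,5^{n-3},2^2\cdot5^{n-3}\}$; if $n$ is odd, then $\mathcal S_7(n)=\{V_n\}$ with $V_n=\{2,2^2\}\cup\{7^i,\,2\cdot7^i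 : 1\le i\le \tfrac{n-3}2\}\cup\{2^2\cdot 7^{(n-3)/2}\}$; if $n$ is even, then $\mathcal S_7(n)=\emptyset$; and $\mathcal S_q(n)=\emptyset$ for every odd prime $q\notin\{3,5,7\}$. 3. $\mathcal S(n)$ is finite, and $|\mathcal S(n)|=\Sigma(n)+2$ if $n$ is odd, $|\mathcal S(n)|=\Sigma(n)+1$ if $n$ is even. -/

import Mathlib

/-- A solution of `1/x₁ + ⋯ + 1/xₙ = 1` in `n` pairwise distinct positive integers,
recorded as the set `{x₁, …, xₙ}`. -/
def IsEgyptianSolution (n : ℕ) (X : Finset ℕ) : Prop :=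
  X.card = n ∧ (∀ x ∈ X, 0 < x) ∧ ∑ x ∈ X, (1 : ℚ) / (x : ℚ) = 1

/-- The solutions all of whose members have the form `2 ^ α * q ^ β` with `α ≤ 2`
(and `β ≥ 0` arbitrary). -/
def solutionsFor (n q : ℕ) : Set (Finset ℕ) :=
  {X | IsEgyptianSolution n X ∧ ∀ x ∈ X, ∃ α β : ℕ, α ≤ 2 ∧ x = 2 ^ α * q ^ β}

/-- The solutions all of whose members have the form `2 ^ α * q ^ β` with `α ≤ 2`,
for some odd prime `q` (the same for all members of the solution). -/
def allSolutions (n : ℕ) : Set (Finset ℕ) :=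
  {X | ∃ q : ℕ, q.Prime ∧ Odd q ∧ X ∈ solutionsFor n q}

/-- `U_n = {2, 2², 5, 5², …, 5^(n-3), 2²·5^(n-3)}`. -/
def solU (n : ℕ) : Finset ℕ :=
  {2, 4} ∪ (Finset.Icc 1 (n - 3)).image (fun i => 5 ^ i) ∪ {2 ^ 2 * 5 ^ (n - 3)}

/-- `V_n = {2, 2², 7, 2·7, 7², 2·7², …, 7^m, 2·7^m, 2²·7^m}` with `m = (n-3)/2`, for odd `n`. -/
def solV (n : ℕ) : Finset ℕ :=
  {2, 4} ∪ (Finset.Icc 1 ((n - 3) / 2)).image (fun i => 7 ^ i)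
    ∪ (Finset.Icc 1 ((n - 3) / 2)).image (fun i => 2 * 7 ^ i)
    ∪ {2 ^ 2 * 7 ^ ((n - 3) / 2)}

/-- Nine integer sequences; only the terms of index `n ≥ 3` are meaningful. -/
structure NineSeq where
  tri : ℕ → ℤ
  sq : ℕ → ℤ
  ast : ℕ → ℤ
  dia : ℕ → ℤ
  St1 : ℕ → ℤ
  St2 : ℕ → ℤ
  St : ℕ → ℤ
  t : ℕ → ℤ
  p : ℕ → ℤ

/-- The linear recurrence system with its initial conditions. Each recurrence is imposed
for exactly those `n` at which the left-hand side is not an initial value; all the indices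
that occur are then at least `3`. -/
structure NineSeq.SolvesSystem (s : NineSeq) : Prop where
  ast_rec : ∀ n, 4 ≤ n → s.ast n = s.ast (n - 1) + s.dia (n - 1) + (if n = 4 then 1 else 0)
  tri_rec : ∀ n, 4 ≤ n →
    s.tri n = s.tri (n - 1) + s.sq (n - 1) + s.St1 (n - 1) + s.St2 (n - 1) + s.St (n - 1)
  sq_rec : ∀ n, 4 ≤ n → s.sq n = s.ast (n - 1) + s.dia (n - 1)
  dia_rec : ∀ n, 5 ≤ n →
    s.dia n = s.tri (n - 2) + s.sq (n - 2) + s.St1 (n - 2) + s.St2 (n - 2) + s.St (n - 2)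
  St1_rec : ∀ n, 6 ≤ n → s.St1 n = s.ast (n - 3) + s.dia (n - 3) + (if n = 6 then 1 else 0)
  St2_rec : ∀ n, 8 ≤ n →
    s.St2 n = s.ast (n - 5) + s.dia (n - 5) + s.t (n - 5) + s.p (n - 5)
      + (if n = 8 then 1 else 0)
  St_rec : ∀ n, 8 ≤ n →
    s.St n = s.tri (n - 5) + s.sq (n - 5) + s.St1 (n - 5) + s.St2 (n - 5) + s.St (n - 5)
  t_rec : ∀ n, 5 ≤ n →
    s.t n = s.ast (n - 2) + s.dia (n - 2) + s.t (n - 2) + s.p (n - 2)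
      + (if n = 5 then 1 else 0)
  p_rec : ∀ n, 5 ≤ n →
    s.p n = s.tri (n - 2) + s.sq (n - 2) + s.St1 (n - 2) + s.St2 (n - 2) + s.St (n - 2)
  tri_init : s.tri 3 = 1
  sq_init : s.sq 3 = 0
  ast_init : s.ast 3 = 0
  dia_init : s.dia 3 = 0 ∧ s.dia 4 = 0
  St1_init : s.St1 3 = 0 ∧ s.St1 4 = 0 ∧ s.St1 5 = 0
  St2_init : s.St2 3 = 0 ∧ s.St2 4 = 0 ∧ s.St2 5 = 0 ∧ s.St2 6 = 0 ∧ s.St2 7 = 0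
  St_init : s.St 3 = 0 ∧ s.St 4 = 0 ∧ s.St 5 = 0 ∧ s.St 6 = 0 ∧ s.St 7 = 0
  t_init : s.t 3 = 0 ∧ s.t 4 = 0
  p_init : s.p 3 = 0 ∧ s.p 4 = 0

/-- Two nine-tuples of sequences agree at the index `n`. -/
def NineSeq.AgreeAt (s s' : NineSeq) (n : ℕ) : Prop :=
  s.tri n = s'.tri n ∧ s.sq n = s'.sq n ∧ s.ast n = s'.ast n ∧ s.dia n = s'.dia n ∧
  s.St1 n = s'.St1 n ∧ s.St2 n = s'.St2 n ∧ s.St n = s'.St n ∧ s.t n = s'.t n ∧ s.p n = s'.p n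

/-- The sum of the first seven components at the index `n`. -/
def NineSeq.firstSeven (s : NineSeq) (n : ℕ) : ℤ :=
  s.tri n + s.sq n + s.ast n + s.dia n + s.St1 n + s.St2 n + s.St n

/-! Multiply the equation by 4 and split a solution as `X = D ∪ qY`, where `D ⊆ {1, 2, 4}` collects
the members prime to `q`. If `X` has weight `∑ 4/x = s`, then `Y` has weight `q (s - d)`, where `d`
is the weight of `D`; since 4, 2, 1 have weights 1, 2, 4, each `d` from 0 to 7 comes from exactly
one `D`. This gives the recursion `encard_smoothSets_eight` on weight and size.

Every weight is below `7q/(q-1)` (`sum_lt_of_isTwoBounded`), so a tail of weight `qr` requires `r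
(q-1) < 7`. For `q > 7` only `r = 0` survives. For `q = 5` and `q = 7` also `r = 1` does, and the
layers of a solution are then forced, giving `U_n` and `V_n`. For `q = 3` there remain `r = 1, 2,
3`, counted by `tailCount`.

The nine-sequence system depends on its past only through the sums `A = ast + dia`, `T = tri + sq +
St1 + St2 + St` and `P = t + p`, and `Σ = A + T`. The count for `q = 3` and `A + T` eventually
satisfy the same recurrence of order 6, so agreement of finitely many values suffices
(`solutionCount_eq`). Solutions for different primes are separated by the members 5 of `U_n` and 7
of `V_n`. -/

/-! ### Splitting a set into its `q`-free part and `q` times a smaller set -/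

/-- `x` has the form `2 ^ α * q ^ β` with `α ≤ 2`. -/
def IsTwoBounded (q x : ℕ) : Prop := ∃ α β : ℕ, α ≤ 2 ∧ x = 2 ^ α * q ^ β

/-- The sets of `w` numbers of the form `2 ^ α * q ^ β` with `α ≤ 2` with `∑ 4 / x = s`. -/
def smoothSets (q s w : ℕ) : Set (Finset ℕ) :=
  {X | X.card = w ∧ (∀ x ∈ X, IsTwoBounded q x) ∧ ∑ x ∈ X, (4 : ℚ) / (x : ℚ) = s}

/-- The set with `q`-free part `D` and with `q • Y` as the part divisible by `q`. -/
def joinSet (q : ℕ) (D Y : Finset ℕ) : Finset ℕ := D ∪ Y.image (q * ·)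

/-- `∑ 4 / x`, for a set `D` of divisors of `4`. -/
def quarterSum (D : Finset ℕ) : ℕ := ∑ x ∈ D, 4 / x

theorem solutionsFor_eq_smoothSets {n q : ℕ} (hq : 0 < q) :
    solutionsFor n q = smoothSets q 4 n := by
  ext X
  have key : ∑ x ∈ X, (4 : ℚ) / (x : ℚ) = 4 * ∑ x ∈ X, (1 : ℚ) / (x : ℚ) := by
    rw [Finset.mul_sum]; exact Finset.sum_congr rfl fun x _ => by ring
  constructor
  · rintro ⟨⟨h1, _, h3⟩, h4⟩
    exact ⟨h1, h4, by rw [key, h3]; norm_num⟩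
  · rintro ⟨h1, h4, h3⟩
    refine ⟨⟨h1, fun x hx => ?_, ?_⟩, h4⟩
    · obtain ⟨α, β, _, rfl⟩ := h4 x hx
      positivity
    · rw [key] at h3; push_cast at h3; linarith

theorem isTwoBounded_of_mem {q x : ℕ} (hx : x ∈ ({1, 2, 4} : Finset ℕ)) : IsTwoBounded q x := by
  simp only [Finset.mem_insert, Finset.mem_singleton] at hx
  rcases hx with rfl | rfl | rfl
  · exact ⟨0, 0, by norm_num, by norm_num⟩
  · exact ⟨1, 0, by norm_num, by norm_num⟩
  · exact ⟨2, 0, by norm_num, by norm_num⟩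

theorem IsTwoBounded.mul {q x : ℕ} (h : IsTwoBounded q x) : IsTwoBounded q (q * x) := by
  obtain ⟨α, β, hα, rfl⟩ := h
  exact ⟨α, β + 1, hα, by ring⟩

theorem not_dvd_of_mem {q x : ℕ} (hq : q.Prime) (ho : Odd q)
    (hx : x ∈ ({1, 2, 4} : Finset ℕ)) : ¬ q ∣ x := by
  intro h
  have h4 : q ∣ 2 ^ 2 := h.trans (by
    simp only [Finset.mem_insert, Finset.mem_singleton] at hx
    rcases hx with rfl | rfl | rfl <;> decide)
  have := (Nat.prime_dvd_prime_iff_eq hq Nat.prime_two).1 (hq.dvd_of_dvd_pow h4)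
  subst this
  exact absurd ho (by decide)

theorem IsTwoBounded.cases {q x : ℕ} (h : IsTwoBounded q x) :
    x ∈ ({1, 2, 4} : Finset ℕ) ∨ ∃ y, IsTwoBounded q y ∧ x = q * y := by
  obtain ⟨α, β, hα, rfl⟩ := h
  rcases β with _ | β
  · left
    interval_cases α <;> simp
  · exact Or.inr ⟨2 ^ α * q ^ β, ⟨α, β, hα, rfl⟩, by ring⟩

section Join

variable {q : ℕ} {D Y : Finset ℕ}

theorem filter_not_dvd_joinSet (hq : q.Prime) (ho : Odd q) (hD : D ⊆ {1, 2, 4}) :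
    (joinSet q D Y).filter (¬ q ∣ ·) = D := by
  ext x
  simp only [joinSet, Finset.mem_filter, Finset.mem_union, Finset.mem_image]
  constructor
  · rintro ⟨h | ⟨y, _, rfl⟩, h2⟩
    · exact h
    · exact absurd (dvd_mul_right q y) h2
  · exact fun h => ⟨Or.inl h, not_dvd_of_mem hq ho (hD h)⟩

theorem filter_dvd_joinSet (hq : q.Prime) (ho : Odd q) (hD : D ⊆ {1, 2, 4}) :
    (joinSet q D Y).filter (q ∣ ·) = Y.image (q * ·) := by
  ext x
  simp only [joinSet, Finset.mem_filter, Finset.mem_union, Finset.mem_image]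
  constructor
  · rintro ⟨h | h, h2⟩
    · exact absurd h2 (not_dvd_of_mem hq ho (hD h))
    · exact h
  · rintro ⟨y, hy, rfl⟩
    exact ⟨Or.inr ⟨y, hy, rfl⟩, dvd_mul_right q y⟩

theorem disjoint_image_mul (hq : q.Prime) (ho : Odd q) (hD : D ⊆ {1, 2, 4}) :
    Disjoint D (Y.image (q * ·)) := by
  rw [Finset.disjoint_left]
  intro x hx h
  obtain ⟨y, _, rfl⟩ := Finset.mem_image.1 h
  exact not_dvd_of_mem hq ho (hD hx) (dvd_mul_right q y)

theorem mul_left_injective_of_prime (hq : q.Prime) : Function.Injective (q * ·) :=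
  fun _ _ h => Nat.eq_of_mul_eq_mul_left hq.pos h

theorem card_joinSet (hq : q.Prime) (ho : Odd q) (hD : D ⊆ {1, 2, 4}) :
    (joinSet q D Y).card = D.card + Y.card := by
  rw [joinSet, Finset.card_union_of_disjoint (disjoint_image_mul hq ho hD),
    Finset.card_image_of_injective _ (mul_left_injective_of_prime hq)]

theorem cast_quarterSum (hD : D ⊆ {1, 2, 4}) :
    ∑ x ∈ D, (4 : ℚ) / (x : ℚ) = quarterSum D := by
  rw [quarterSum, Nat.cast_sum]
  refine Finset.sum_congr rfl fun x hx => ?_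
  have := hD hx
  simp only [Finset.mem_insert, Finset.mem_singleton] at this
  rcases this with rfl | rfl | rfl <;> norm_num

theorem sum_joinSet (hq : q.Prime) (ho : Odd q) (hD : D ⊆ {1, 2, 4}) :
    ∑ x ∈ joinSet q D Y, (4 : ℚ) / (x : ℚ)
      = quarterSum D + (∑ x ∈ Y, (4 : ℚ) / (x : ℚ)) / q := by
  rw [joinSet, Finset.sum_union (disjoint_image_mul hq ho hD), cast_quarterSum hD,
    Finset.sum_image (mul_left_injective_of_prime hq).injOn, Finset.sum_div]
  congr 1
  refine Finset.sum_congr rfl fun x _ => ?_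
  rw [Nat.cast_mul, div_div, mul_comm]

theorem joinSet_injective (hq : q.Prime) (ho : Odd q) (hD : D ⊆ {1, 2, 4}) :
    Function.Injective (joinSet q D) := by
  intro Y Y' h
  apply Finset.image_injective (mul_left_injective_of_prime hq)
  rw [← filter_dvd_joinSet hq ho hD, h, filter_dvd_joinSet hq ho hD]

end Join

theorem exists_joinSet {q : ℕ} (hq : q.Prime) {X : Finset ℕ}
    (hX : ∀ x ∈ X, IsTwoBounded q x) :
    ∃ D ⊆ ({1, 2, 4} : Finset ℕ), ∃ Y : Finset ℕ, (∀ y ∈ Y, IsTwoBounded q y) ∧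
      X = joinSet q D Y := by
  classical
  refine ⟨X.filter (· ∈ ({1, 2, 4} : Finset ℕ)), fun x hx => (Finset.mem_filter.1 hx).2,
    (X.filter (· ∉ ({1, 2, 4} : Finset ℕ))).image (· / q), ?_, ?_⟩
  · intro y hy
    obtain ⟨x, hx, rfl⟩ := Finset.mem_image.1 hy
    obtain ⟨hx, hx'⟩ := Finset.mem_filter.1 hx
    obtain ⟨z, hz, rfl⟩ := (hX x hx).cases.resolve_left hx'
    simpa [hq.pos] using hz
  · ext x
    simp only [joinSet, Finset.mem_union, Finset.mem_image, exists_exists_and_eq_and]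
    constructor
    · intro hx
      by_cases h : x ∈ ({1, 2, 4} : Finset ℕ)
      · exact Or.inl (Finset.mem_filter.2 ⟨hx, h⟩)
      · obtain ⟨y, _, rfl⟩ := (hX x hx).cases.resolve_left h
        exact Or.inr ⟨q * y, Finset.mem_filter.2 ⟨hx, h⟩, by simp [hq.pos]⟩
    · rintro (h | ⟨z, hz, rfl⟩)
      · exact (Finset.mem_filter.1 h).1
      · obtain ⟨hz, hz'⟩ := Finset.mem_filter.1 hz
        obtain ⟨y, _, rfl⟩ := (hX z hz).cases.resolve_left hz'
        simpa [hq.pos] using hz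

/-! ### Bound on the attainable weights -/

/-- The exponents of 2 contribute `4 + 2 + 1 = 7`, and the powers of `q` a finite part of a
geometric series with sum `q/(q-1)`. -/
theorem sum_lt_of_isTwoBounded {q : ℕ} (hq : 2 ≤ q) {X : Finset ℕ}
    (hX : ∀ x ∈ X, IsTwoBounded q x) :
    (∑ x ∈ X, (4 : ℚ) / (x : ℚ)) * (q - 1) < 7 * q := by
  have hq' : (2 : ℚ) ≤ q := by exact_mod_cast hq
  choose! α β hα hx using hX
  obtain ⟨m, hm⟩ : ∃ m, ∀ x ∈ X, β x < m :=
    ⟨X.sup β + 1, fun x hx => Nat.lt_succ_of_le (Finset.le_sup hx)⟩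
  have h1 : ∑ x ∈ X, (4 : ℚ) / (x : ℚ)
      ≤ ∑ p ∈ Finset.range 3 ×ˢ Finset.range m, 4 / ((2 : ℚ) ^ p.1 * q ^ p.2) := by
    have hinj : Set.InjOn (fun x => (α x, β x)) X := by
      intro x hx1 y hy1 h
      simp only [Prod.mk.injEq] at h
      rw [hx x hx1, hx y hy1, h.1, h.2]
    calc ∑ x ∈ X, (4 : ℚ) / (x : ℚ)
        = ∑ p ∈ X.image (fun x => (α x, β x)), 4 / ((2 : ℚ) ^ p.1 * q ^ p.2) := by
          rw [Finset.sum_image hinj]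
          refine Finset.sum_congr rfl fun x hx1 => ?_
          conv_lhs => rw [hx x hx1]
          push_cast; rfl
      _ ≤ _ := by
          refine Finset.sum_le_sum_of_subset_of_nonneg ?_ fun _ _ _ => by positivity
          intro p hp
          obtain ⟨x, hx1, rfl⟩ := Finset.mem_image.1 hp
          simp only [Finset.mem_product, Finset.mem_range]
          exact ⟨Nat.lt_succ_of_le (hα x hx1), hm x hx1⟩
  have h2 : ∑ p ∈ Finset.range 3 ×ˢ Finset.range m, 4 / ((2 : ℚ) ^ p.1 * q ^ p.2)
      = 7 * ∑ b ∈ Finset.range m, ((q : ℚ)⁻¹) ^ b := by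
    rw [Finset.sum_product, Finset.mul_sum]
    simp only [Finset.sum_range_succ, Finset.sum_range_zero, ← Finset.sum_add_distrib, zero_add]
    refine Finset.sum_congr rfl fun b _ => ?_
    rw [inv_pow]
    field_simp
    norm_num
  have h3 : (∑ b ∈ Finset.range m, ((q : ℚ)⁻¹) ^ b) * (q - 1) < q := by
    have h := geom_sum_mul_neg ((q : ℚ)⁻¹) m
    have h5 : (0 : ℚ) < (q : ℚ)⁻¹ ^ m := by positivity
    have h6 : (q : ℚ) - 1 = q * (1 - (q : ℚ)⁻¹) := by field_simp
    rw [h6, mul_left_comm, h]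
    nlinarith
  rw [h2] at h1
  nlinarith [mul_le_mul_of_nonneg_right h1 (by linarith : (0 : ℚ) ≤ (q : ℚ) - 1)]

theorem smoothSets_eq_empty {q s w : ℕ} (hq : 2 ≤ q) (h : 7 * q ≤ s * (q - 1)) :
    smoothSets q s w = ∅ := by
  rw [Set.eq_empty_iff_forall_notMem]
  rintro X ⟨_, h2, h3⟩
  have := sum_lt_of_isTwoBounded hq h2
  rw [h3, ← Nat.cast_one, ← Nat.cast_sub (by omega)] at this
  norm_cast at this
  omega

theorem smoothSets_zero_left {q : ℕ} (hq : 0 < q) (w : ℕ) :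
    smoothSets q 0 w = if w = 0 then {∅} else ∅ := by
  ext X
  have key : X ∈ smoothSets q 0 w ↔ X = ∅ ∧ w = 0 := by
    constructor
    · rintro ⟨h1, h2, h3⟩
      have hX : X = ∅ := by
        by_contra hne
        refine absurd h3 (ne_of_gt ?_)
        push_cast
        refine Finset.sum_pos (fun x hx => ?_) (Finset.nonempty_iff_ne_empty.2 hne)
        obtain ⟨α, β, _, rfl⟩ := h2 x hx
        push_cast
        positivity
      subst hX
      exact ⟨rfl, by simpa using h1.symm⟩
    · rintro ⟨rfl, rfl⟩
      simp [smoothSets]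
  rw [key]
  split_ifs with h <;> simp [h]

/-! ### Recursion on weight and size -/

/-- The `q`-free parts that are possible for a member of `smoothSets q s w`. -/
def admissibleParts (s w : ℕ) : Finset (Finset ℕ) :=
  (Finset.powerset {1, 2, 4}).filter fun D => quarterSum D ≤ s ∧ D.card ≤ w

theorem smoothSets_eq_biUnion {q : ℕ} (hq : q.Prime) (ho : Odd q) (s w : ℕ) :
    smoothSets q s w = ⋃ D ∈ (admissibleParts s w : Set (Finset ℕ)),
      joinSet q D '' smoothSets q (q * (s - quarterSum D)) (w - D.card) := by
  have hq0 : (0 : ℚ) < q := by exact_mod_cast hq.pos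
  ext X
  simp only [Set.mem_iUnion, Set.mem_image, admissibleParts, Finset.mem_coe, Finset.mem_filter,
    Finset.mem_powerset, exists_prop]
  constructor
  · rintro ⟨h1, h2, h3⟩
    obtain ⟨D, hD, Y, hY, rfl⟩ := exists_joinSet hq h2
    rw [card_joinSet hq ho hD] at h1
    rw [sum_joinSet hq ho hD] at h3
    have hY0 : 0 ≤ ∑ x ∈ Y, (4 : ℚ) / (x : ℚ) := Finset.sum_nonneg fun _ _ => by positivity
    have hs : quarterSum D ≤ s := by
      have : (quarterSum D : ℚ) ≤ s := by rw [← h3]; linarith [div_nonneg hY0 hq0.le]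
      exact_mod_cast this
    refine ⟨D, ⟨hD, hs, by omega⟩, Y, ⟨by omega, hY, ?_⟩, rfl⟩
    rw [Nat.cast_mul, Nat.cast_sub hs, ← h3]
    field_simp
    ring
  · rintro ⟨D, ⟨hD, hs, hw⟩, Y, ⟨h1, h2, h3⟩, rfl⟩
    refine ⟨by rw [card_joinSet hq ho hD]; omega, fun x hx => ?_, ?_⟩
    · rcases Finset.mem_union.1 hx with h | h
      · exact isTwoBounded_of_mem (hD h)
      · obtain ⟨y, hy, rfl⟩ := Finset.mem_image.1 h
        exact (h2 y hy).mul
    · rw [sum_joinSet hq ho hD, h3, Nat.cast_mul, Nat.cast_sub hs]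
      field_simp
      ring

/-- Counting with `encard` needs no finiteness in advance: finiteness follows once the recursion
evaluates to a natural number. -/
theorem encard_smoothSets {q : ℕ} (hq : q.Prime) (ho : Odd q) (s w : ℕ) :
    (smoothSets q s w).encard = ∑ D ∈ Finset.powerset {1, 2, 4},
      if quarterSum D ≤ s ∧ D.card ≤ w then
        (smoothSets q (q * (s - quarterSum D)) (w - D.card)).encard else 0 := by
  have hsub : ∀ D ∈ (admissibleParts s w : Set (Finset ℕ)), D ⊆ {1, 2, 4} := fun D hD =>
    Finset.mem_powerset.1 (Finset.mem_filter.1 (Finset.mem_coe.1 hD)).1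
  rw [smoothSets_eq_biUnion hq ho s w, Set.Finite.encard_biUnion (Finset.finite_toSet _),
    finsum_mem_coe_finset, admissibleParts, Finset.sum_filter]
  · refine Finset.sum_congr rfl fun D hD => ?_
    rw [(joinSet_injective hq ho (Finset.mem_powerset.1 hD)).encard_image]
  -- `D` is recovered from the joined set as its members not divisible by `q`, so different `D` give
  -- disjoint families.
  · intro D hD D' hD' hne
    rw [Function.onFun, Set.disjoint_left]
    rintro _ ⟨Y, _, rfl⟩ ⟨Y', _, h⟩
    apply hne
    rw [← filter_not_dvd_joinSet (Y := Y) hq ho (hsub D hD), ← h,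
      filter_not_dvd_joinSet hq ho (hsub D' hD')]

/-- The subsets are listed so that their values of `quarterSum` run through 0, 1, ..., 7 in order.
-/
theorem sum_powerset_one_two_four {M : Type*} [AddCommMonoid M] (f : Finset ℕ → M) :
    ∑ D ∈ Finset.powerset {1, 2, 4}, f D
      = f ∅ + f {4} + f {2} + f {2, 4} + f {1} + f {1, 4} + f {1, 2} + f {1, 2, 4} := by
  have h4 : ∀ g : Finset ℕ → M, ∑ D ∈ Finset.powerset {4}, g D = g ∅ + g {4} := fun g => by
    rw [← insert_empty_eq, Finset.sum_powerset_insert (by decide)]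
    simp
  rw [Finset.sum_powerset_insert (by decide), Finset.sum_powerset_insert (by decide),
    Finset.sum_powerset_insert (by decide)]
  simp only [h4, insert_empty_eq]
  abel

/-- The recursion for the number of solutions, by the `q`-free part. -/
theorem encard_smoothSets_eight {q : ℕ} (hq : q.Prime) (ho : Odd q) (s w : ℕ) :
    (smoothSets q s w).encard =
      (smoothSets q (q * s) w).encard
      + (if 1 ≤ s ∧ 1 ≤ w then (smoothSets q (q * (s - 1)) (w - 1)).encard else 0)
      + (if 2 ≤ s ∧ 1 ≤ w then (smoothSets q (q * (s - 2)) (w - 1)).encard else 0)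
      + (if 3 ≤ s ∧ 2 ≤ w then (smoothSets q (q * (s - 3)) (w - 2)).encard else 0)
      + (if 4 ≤ s ∧ 1 ≤ w then (smoothSets q (q * (s - 4)) (w - 1)).encard else 0)
      + (if 5 ≤ s ∧ 2 ≤ w then (smoothSets q (q * (s - 5)) (w - 2)).encard else 0)
      + (if 6 ≤ s ∧ 2 ≤ w then (smoothSets q (q * (s - 6)) (w - 2)).encard else 0)
      + (if 7 ≤ s ∧ 3 ≤ w then (smoothSets q (q * (s - 7)) (w - 3)).encard else 0) := by
  rw [encard_smoothSets hq ho, sum_powerset_one_two_four]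
  simp [quarterSum]

theorem smoothSets_mul_eq_empty {q r w : ℕ} (hq : 2 ≤ q) (h : 7 ≤ r * (q - 1)) :
    smoothSets q (q * r) w = ∅ :=
  smoothSets_eq_empty hq (by nlinarith [Nat.mul_le_mul_left q h])

theorem encard_smoothSets_zero {q : ℕ} (hq : 0 < q) (w : ℕ) :
    (smoothSets q 0 w).encard = if w = 0 then 1 else 0 := by
  rw [smoothSets_zero_left hq]
  split_ifs <;> simp

/-- Additive form of one recursion step, used to exhibit members explicitly. -/
theorem joinSet_mem_smoothSets {q s w : ℕ} {D Y : Finset ℕ} (hq : q.Prime) (ho : Odd q)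
    (hD : D ⊆ {1, 2, 4}) (hY : Y ∈ smoothSets q (q * s) w) :
    joinSet q D Y ∈ smoothSets q (quarterSum D + s) (D.card + w) := by
  obtain ⟨h1, h2, h3⟩ := hY
  have hq0 : (q : ℚ) ≠ 0 := by exact_mod_cast hq.pos.ne'
  refine ⟨by rw [card_joinSet hq ho hD, h1], fun x hx => ?_, ?_⟩
  · rcases Finset.mem_union.1 hx with h | h
    · exact isTwoBounded_of_mem (hD h)
    · obtain ⟨y, hy, rfl⟩ := Finset.mem_image.1 h
      exact (h2 y hy).mul
  · rw [sum_joinSet hq ho hD, h3]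
    push_cast
    field_simp

/-! ### Counting for the primes other than 3 -/

/-- Only remainders 0 and 1 are possible: `D = {1, 4}` ends the tail, and `D = {1}` leaves weight 5
again with one member fewer. Hence there is one tail of each size from 2 on. -/
theorem encard_smoothSets_five (w : ℕ) :
    (smoothSets 5 5 (w + 2)).encard = 1 ∧ (smoothSets 5 5 1).encard = 0
      ∧ (smoothSets 5 5 0).encard = 0 := by
  have e : ∀ r w, 2 ≤ r → smoothSets 5 (5 * r) w = ∅ := fun r w h =>
    smoothSets_mul_eq_empty (by norm_num) (by omega)
  have key := encard_smoothSets_eight (q := 5) (by norm_num) (by decide) 5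
  simp only [Nat.reduceLeDiff, Nat.reduceSub, true_and, false_and, if_false, e _ _ (le_refl 2),
    e 3 _ (by norm_num), e 4 _ (by norm_num), e 5 _ (by norm_num), Set.encard_empty, ite_self,
    mul_zero, mul_one, encard_smoothSets_zero (show 0 < 5 by norm_num), zero_add, add_zero]
    at key
  have h0 : (smoothSets 5 5 0).encard = 0 := by rw [key]; rfl
  have h1 : (smoothSets 5 5 1).encard = 0 := by rw [key]; simp [h0]
  refine ⟨?_, h1, h0⟩
  induction w with
  | zero => rw [key]; simp [h1]
  | succ w ih => rw [key]; simp [ih]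

/-- `D = {1, 2, 4}` ends the tail and `D = {1, 2}` reproduces weight 7 with two members fewer, so
the size must be odd and at least 3. -/
theorem encard_smoothSets_seven (w : ℕ) :
    (smoothSets 7 7 (2 * w + 3)).encard = 1 ∧ (smoothSets 7 7 (2 * w)).encard = 0 := by
  have e : ∀ r w, 2 ≤ r → smoothSets 7 (7 * r) w = ∅ := fun r w h =>
    smoothSets_mul_eq_empty (by norm_num) (by omega)
  have key := encard_smoothSets_eight (q := 7) (by norm_num) (by decide) 7
  simp only [Nat.reduceLeDiff, Nat.reduceSub, true_and, e _ _ (le_refl 2),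
    e 3 _ (by norm_num), e 4 _ (by norm_num), e 5 _ (by norm_num), e 6 _ (by norm_num),
    e 7 _ (by norm_num), Set.encard_empty, ite_self,
    mul_zero, mul_one, encard_smoothSets_zero (show 0 < 7 by norm_num), zero_add, add_zero]
    at key
  have h0 : (smoothSets 7 7 0).encard = 0 := by rw [key]; rfl
  have h1 : (smoothSets 7 7 1).encard = 0 := by rw [key]; rfl
  induction w with
  | zero => exact ⟨by rw [key]; simp [h1], h0⟩
  | succ w ih =>
    refine ⟨?_, ?_⟩
    · rw [key, show 2 * (w + 1) + 3 - 2 = 2 * w + 3 by omega, ih.1]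
      simp
    · rw [key, show 2 * (w + 1) - 2 = 2 * w by omega, ih.2]
      split_ifs <;> first | omega | simp

theorem encard_smoothSets_five_four (w : ℕ) : (smoothSets 5 4 (w + 4)).encard = 1 := by
  have e : ∀ r w, 2 ≤ r → smoothSets 5 (5 * r) w = ∅ := fun r w h =>
    smoothSets_mul_eq_empty (by norm_num) (by omega)
  have key := encard_smoothSets_eight (q := 5) (by norm_num) (by decide) 4 (w + 4)
  simp only [Nat.reduceLeDiff, Nat.reduceSub, true_and, false_and, if_false, e _ _ (le_refl 2),
    e 3 _ (by norm_num), e 4 _ (by norm_num), Set.encard_empty, ite_self,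
    mul_zero, mul_one, encard_smoothSets_zero (show 0 < 5 by norm_num), zero_add, add_zero]
    at key
  rw [key, show w + 4 - 2 = w + 2 by omega, (encard_smoothSets_five w).1]
  simp

theorem encard_smoothSets_seven_four (w : ℕ) :
    (smoothSets 7 4 (w + 4)).encard = (smoothSets 7 7 (w + 2)).encard := by
  have e : ∀ r w, 2 ≤ r → smoothSets 7 (7 * r) w = ∅ := fun r w h =>
    smoothSets_mul_eq_empty (by norm_num) (by omega)
  have key := encard_smoothSets_eight (q := 7) (by norm_num) (by decide) 4 (w + 4)
  simp only [Nat.reduceLeDiff, Nat.reduceSub, true_and, false_and, if_false, e _ _ (le_refl 2),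
    e 3 _ (by norm_num), e 4 _ (by norm_num), Set.encard_empty, ite_self,
    mul_zero, mul_one, encard_smoothSets_zero (show 0 < 7 by norm_num), zero_add, add_zero]
    at key
  rw [key, show w + 4 - 2 = w + 2 by omega]
  simp

/-- Here `q - 1 ≥ 7` rules out every nonzero remainder, so only `X = {1}` has weight 4, and it has a
single member. -/
theorem smoothSets_four_eq_empty {q w : ℕ} (hq : q.Prime) (h8 : 8 ≤ q) :
    smoothSets q 4 (w + 2) = ∅ := by
  have ho : Odd q := hq.odd_of_ne_two (by omega)
  have e : ∀ r w, 1 ≤ r → smoothSets q (q * r) w = ∅ := fun r w h =>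
    smoothSets_mul_eq_empty (by omega)
      (by nlinarith [Nat.mul_le_mul h (show 7 ≤ q - 1 by omega)])
  have key := encard_smoothSets_eight hq ho 4 (w + 2)
  simp only [Nat.reduceLeDiff, Nat.reduceSub, true_and, false_and, if_false, e _ _ (le_refl 1),
    e 2 _ (by norm_num), e 3 _ (by norm_num), e 4 _ (by norm_num), Set.encard_empty, ite_self,
    mul_zero, encard_smoothSets_zero hq.pos, zero_add, add_zero] at key
  rw [← Set.encard_eq_zero, key]
  simp

/-! ### The explicit solutions `U_n` and `V_n` -/

/-- The tails `{1, 5, …, 5 ^ k, 4 * 5 ^ k}`. -/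
def tailFive : ℕ → Finset ℕ
  | 0 => {1, 4}
  | k + 1 => joinSet 5 {1} (tailFive k)

/-- The tails `{1, 2, 7, 2 * 7, …, 7 ^ k, 2 * 7 ^ k, 4 * 7 ^ k}`. -/
def tailSeven : ℕ → Finset ℕ
  | 0 => {1, 2, 4}
  | k + 1 => joinSet 7 {1, 2} (tailSeven k)

theorem empty_mem_smoothSets (q : ℕ) : ∅ ∈ smoothSets q (q * 0) 0 := by
  simp [smoothSets]

theorem joinSet_empty (q : ℕ) (D : Finset ℕ) : joinSet q D ∅ = D := by
  simp [joinSet]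

theorem tailFive_mem (k : ℕ) : tailFive k ∈ smoothSets 5 5 (k + 2) := by
  induction k with
  | zero =>
    have := joinSet_mem_smoothSets (q := 5) (D := {1, 4}) (by norm_num) (by decide) (by decide)
      (empty_mem_smoothSets 5)
    simpa [joinSet_empty, quarterSum, tailFive] using this
  | succ k ih =>
    have := joinSet_mem_smoothSets (q := 5) (s := 1) (D := {1}) (by norm_num) (by decide)
      (by decide) ih
    rw [show k + 1 + 2 = 1 + (k + 2) by omega]
    simpa [quarterSum, tailFive] using this

theorem tailSeven_mem (k : ℕ) : tailSeven k ∈ smoothSets 7 7 (2 * k + 3) := by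
  induction k with
  | zero =>
    have := joinSet_mem_smoothSets (q := 7) (D := {1, 2, 4}) (by norm_num) (by decide)
      (by decide) (empty_mem_smoothSets 7)
    simpa [joinSet_empty, quarterSum, tailSeven] using this
  | succ k ih =>
    have := joinSet_mem_smoothSets (q := 7) (s := 1) (D := {1, 2}) (by norm_num) (by decide)
      (by decide) ih
    rw [show 2 * (k + 1) + 3 = 2 + (2 * k + 3) by omega]
    simpa [quarterSum, tailSeven] using this

theorem mem_tailFive {k x : ℕ} : x ∈ tailFive k ↔ (∃ i ≤ k, x = 5 ^ i) ∨ x = 4 * 5 ^ k := by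
  induction k generalizing x with
  | zero => simp [tailFive]
  | succ k ih =>
    simp only [tailFive, joinSet, Finset.mem_union, Finset.mem_singleton, Finset.mem_image, ih]
    constructor
    · rintro (rfl | ⟨y, ⟨i, hi, rfl⟩ | rfl, rfl⟩)
      · exact Or.inl ⟨0, by omega, rfl⟩
      · exact Or.inl ⟨i + 1, by omega, by ring⟩
      · exact Or.inr (by ring)
    · rintro (⟨i, hi, rfl⟩ | rfl)
      · rcases i with _ | i
        · exact Or.inl rfl
        · exact Or.inr ⟨5 ^ i, Or.inl ⟨i, by omega, rfl⟩, by ring⟩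
      · exact Or.inr ⟨4 * 5 ^ k, Or.inr rfl, by ring⟩

theorem mem_tailSeven {k x : ℕ} : x ∈ tailSeven k ↔
    (∃ i ≤ k, x = 7 ^ i) ∨ (∃ i ≤ k, x = 2 * 7 ^ i) ∨ x = 4 * 7 ^ k := by
  induction k generalizing x with
  | zero => simp [tailSeven]
  | succ k ih =>
    simp only [tailSeven, joinSet, Finset.mem_union, Finset.mem_singleton, Finset.mem_insert,
      Finset.mem_image, ih]
    constructor
    · rintro ((rfl | rfl) | ⟨y, ⟨i, hi, rfl⟩ | ⟨i, hi, rfl⟩ | rfl, rfl⟩)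
      · exact Or.inl ⟨0, by omega, rfl⟩
      · exact Or.inr (Or.inl ⟨0, by omega, rfl⟩)
      · exact Or.inl ⟨i + 1, by omega, by ring⟩
      · exact Or.inr (Or.inl ⟨i + 1, by omega, by ring⟩)
      · exact Or.inr (Or.inr (by ring))
    · rintro (⟨i, hi, rfl⟩ | ⟨i, hi, rfl⟩ | rfl)
      · rcases i with _ | i
        · exact Or.inl (Or.inl rfl)
        · exact Or.inr ⟨7 ^ i, Or.inl ⟨i, by omega, rfl⟩, by ring⟩
      · rcases i with _ | i
        · exact Or.inl (Or.inr rfl)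
        · exact Or.inr ⟨2 * 7 ^ i, Or.inr (Or.inl ⟨i, by omega, rfl⟩), by ring⟩
      · exact Or.inr ⟨4 * 7 ^ k, Or.inr (Or.inr rfl), by ring⟩

theorem solU_eq (k : ℕ) : solU (k + 4) = joinSet 5 {2, 4} (tailFive k) := by
  ext x
  simp only [solU, joinSet, Finset.mem_union, Finset.mem_image, Finset.mem_Icc,
    Finset.mem_singleton, show k + 4 - 3 = k + 1 by omega, mem_tailFive, or_assoc]
  refine or_congr Iff.rfl ?_
  constructor
  · rintro (⟨i, ⟨h1, h2⟩, rfl⟩ | rfl)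
    · obtain ⟨i, rfl⟩ := Nat.exists_eq_add_of_le' h1
      exact ⟨5 ^ i, Or.inl ⟨i, by omega, rfl⟩, by ring⟩
    · exact ⟨_, Or.inr rfl, by ring⟩
  · rintro ⟨y, ⟨i, hi, rfl⟩ | rfl, rfl⟩
    · exact Or.inl ⟨i + 1, by omega, by ring⟩
    · exact Or.inr (by ring)

theorem solV_eq (k : ℕ) : solV (2 * k + 5) = joinSet 7 {2, 4} (tailSeven k) := by
  ext x
  simp only [solV, joinSet, Finset.mem_union, Finset.mem_image, Finset.mem_Icc,
    Finset.mem_singleton, show (2 * k + 5 - 3) / 2 = k + 1 by omega, mem_tailSeven, or_assoc]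
  refine or_congr Iff.rfl ?_
  constructor
  · rintro (⟨i, ⟨h1, h2⟩, rfl⟩ | ⟨i, ⟨h1, h2⟩, rfl⟩ | rfl)
    · obtain ⟨i, rfl⟩ := Nat.exists_eq_add_of_le' h1
      exact ⟨7 ^ i, Or.inl ⟨i, by omega, rfl⟩, by ring⟩
    · obtain ⟨i, rfl⟩ := Nat.exists_eq_add_of_le' h1
      exact ⟨2 * 7 ^ i, Or.inr (Or.inl ⟨i, by omega, rfl⟩), by ring⟩
    · exact ⟨_, Or.inr (Or.inr rfl), by ring⟩
  · rintro ⟨y, ⟨i, hi, rfl⟩ | ⟨i, hi, rfl⟩ | rfl, rfl⟩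
    · exact Or.inl ⟨i + 1, by omega, by ring⟩
    · exact Or.inr (Or.inl ⟨i + 1, by omega, by ring⟩)
    · exact Or.inr (Or.inr (by ring))

theorem Set.eq_singleton_of_encard_eq_one {α : Type*} {s : Set α} {a : α} (h : s.encard = 1)
    (ha : a ∈ s) : s = {a} := by
  obtain ⟨b, rfl⟩ := Set.encard_eq_one.1 h
  rw [Set.mem_singleton_iff.1 ha]

theorem solutionsFor_five {n : ℕ} (hn : 4 ≤ n) : solutionsFor n 5 = {solU n} := by
  obtain ⟨k, rfl⟩ := Nat.exists_eq_add_of_le' hn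
  rw [solutionsFor_eq_smoothSets (by norm_num)]
  refine Set.eq_singleton_of_encard_eq_one (encard_smoothSets_five_four k) ?_
  have := joinSet_mem_smoothSets (q := 5) (s := 1) (D := {2, 4}) (by norm_num) (by decide)
    (by decide) (tailFive_mem k)
  rw [solU_eq, show k + 4 = 2 + (k + 2) by omega]
  simpa [quarterSum] using this

theorem solutionsFor_seven_odd {n : ℕ} (hn : 5 ≤ n) (ho : Odd n) :
    solutionsFor n 7 = {solV n} := by
  obtain ⟨k, rfl⟩ : ∃ k, n = 2 * k + 5 := by
    obtain ⟨j, rfl⟩ := ho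
    exact ⟨j - 2, by omega⟩
  rw [solutionsFor_eq_smoothSets (by norm_num)]
  refine Set.eq_singleton_of_encard_eq_one ?_ ?_
  · rw [show 2 * k + 5 = 2 * k + 1 + 4 by omega, encard_smoothSets_seven_four]
    exact (encard_smoothSets_seven k).1
  · have := joinSet_mem_smoothSets (q := 7) (s := 1) (D := {2, 4}) (by norm_num) (by decide)
      (by decide) (tailSeven_mem k)
    rw [solV_eq, show 2 * k + 5 = 2 + (2 * k + 3) by omega]
    simpa [quarterSum] using this

theorem solutionsFor_seven_even {n : ℕ} (hn : 4 ≤ n) (he : Even n) :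
    solutionsFor n 7 = ∅ := by
  obtain ⟨k, rfl⟩ : ∃ k, n = 2 * k + 4 := by
    obtain ⟨j, rfl⟩ := he
    exact ⟨j - 2, by omega⟩
  rw [solutionsFor_eq_smoothSets (by norm_num), ← Set.encard_eq_zero,
    encard_smoothSets_seven_four]
  exact (encard_smoothSets_seven (k + 1)).2

theorem solutionsFor_of_ne {n q : ℕ} (hn : 2 ≤ n) (hq : q.Prime) (ho : Odd q) (h3 : q ≠ 3)
    (h5 : q ≠ 5) (h7 : q ≠ 7) : solutionsFor n q = ∅ := by
  obtain ⟨k, rfl⟩ := Nat.exists_eq_add_of_le' hn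
  rw [solutionsFor_eq_smoothSets hq.pos]
  refine smoothSets_four_eq_empty hq ?_
  by_contra h
  have h2 := hq.two_le
  interval_cases q <;> first | omega | exact absurd ho (by decide)

/-! ### Counting for the prime 3 -/

/-- The number of members of `smoothSets 3 (3 * r) w` for `r = 1, 2, 3`. -/
def tailCount : ℕ → ℕ × ℕ × ℕ
  | 0 => (0, 0, 0)
  | 1 => (0, 0, 0)
  | 2 => (1, 1, 0)
  | w + 3 =>
    ((tailCount (w + 1)).2.2 + (tailCount w).2.1 + (tailCount (w + 2)).2.1 + (tailCount (w + 2)).1,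
      (tailCount (w + 1)).2.2 + (tailCount (w + 2)).2.1 + (tailCount (w + 1)).1,
      (tailCount (w + 1)).2.2 + (tailCount w).2.1)

theorem encard_smoothSets_three (w : ℕ) :
    (smoothSets 3 3 w).encard = ((tailCount w).1 : ℕ∞) ∧
    (smoothSets 3 6 w).encard = ((tailCount w).2.1 : ℕ∞) ∧
    (smoothSets 3 9 w).encard = ((tailCount w).2.2 : ℕ∞) := by
  have e : ∀ r w, 4 ≤ r → smoothSets 3 (3 * r) w = ∅ := fun r w h =>
    smoothSets_mul_eq_empty (by norm_num) (by omega)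
  have key := encard_smoothSets_eight (q := 3) (by norm_num) (by decide)
  have k3 := key 3
  have k6 := key 6
  have k9 := key 9
  simp only [Nat.reduceLeDiff, Nat.reduceSub, true_and, false_and, if_false, e _ _ (le_refl 4),
    e 5 _ (by norm_num), e 6 _ (by norm_num), e 7 _ (by norm_num), e 8 _ (by norm_num),
    e 9 _ (by norm_num), Set.encard_empty, ite_self, Nat.reduceMul,
    mul_zero, mul_one, encard_smoothSets_zero (show 0 < 3 by norm_num), zero_add, add_zero]
    at k3 k6 k9
  induction w using Nat.strong_induction_on with
  | _ w ih =>
    -- Weight 9 comes first: the choice `D = ∅` sends weight 3 to weight 9 at the same size `w`,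
    -- which is not covered by the induction hypothesis.
    have h9 : (smoothSets 3 9 w).encard = ((tailCount w).2.2 : ℕ∞) := by
      rw [k9]
      match w, ih with
      | 0, _ => simp [tailCount]
      | 1, _ => simp [tailCount]
      | 2, ih => simp [tailCount, (ih 0 (by norm_num)).2.2]
      | w + 3, ih =>
        simp [tailCount, (ih w (by omega)).2.1, (ih (w + 1) (by omega)).2.2,
          show w + 3 - 2 = w + 1 by omega]
    refine ⟨?_, ?_, h9⟩
    · rw [k3, h9]
      match w, ih with
      | 0, _ => simp [tailCount]
      | 1, ih => simp [tailCount, (ih 0 (by norm_num)).1, (ih 0 (by norm_num)).2.1]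
      | 2, ih => simp [tailCount, (ih 1 (by norm_num)).1, (ih 1 (by norm_num)).2.1]
      | w + 3, ih =>
        simp [tailCount, (ih (w + 2) (by omega)).1, (ih (w + 2) (by omega)).2.1,
          show w + 3 - 1 = w + 2 by omega]
    · rw [k6]
      match w, ih with
      | 0, _ => simp [tailCount]
      | 1, ih => simp [tailCount, (ih 0 (by norm_num)).2.1]
      | 2, ih =>
        simp [tailCount, (ih 1 (by norm_num)).2.1, (ih 0 (by norm_num)).1,
          (ih 0 (by norm_num)).2.2]
      | w + 3, ih =>
        simp [tailCount, (ih (w + 2) (by omega)).2.1, (ih (w + 1) (by omega)).1,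
          (ih (w + 1) (by omega)).2.2, show w + 3 - 1 = w + 2 by omega,
          show w + 3 - 2 = w + 1 by omega]

/-- The number of solutions over the prime `3` with `w + 3` members. -/
def solutionCount (w : ℕ) : ℕ :=
  (tailCount (w + 1)).1 + (tailCount (w + 2)).2.1 + (tailCount (w + 2)).2.2

/-- `D = {4}, {2}, {2, 4}` leave tails of weight 9, 6, 3; `D = {1}` would leave an empty tail, which
is excluded by the size. -/
theorem encard_solutionsFor_three (w : ℕ) :
    (solutionsFor (w + 3) 3).encard = (solutionCount w : ℕ∞) := by
  rw [solutionsFor_eq_smoothSets (by norm_num)]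
  have e : smoothSets 3 (3 * 4) (w + 3) = ∅ :=
    smoothSets_mul_eq_empty (by norm_num) (by norm_num)
  have key := encard_smoothSets_eight (q := 3) (by norm_num) (by decide) 4 (w + 3)
  simp only [Nat.reduceLeDiff, Nat.reduceSub, true_and, false_and, if_false, e,
    Set.encard_empty, Nat.reduceMul,
    mul_zero, mul_one, encard_smoothSets_zero (show 0 < 3 by norm_num), zero_add, add_zero] at key
  rw [key]
  simp [show w + 3 - 1 = w + 2 by omega, show w + 3 - 2 = w + 1 by omega,
    encard_smoothSets_three, solutionCount]
  ring

/-! ### The system of nine sequences -/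

/-- The sums `ast + dia`, `tri + sq + St1 + St2 + St` and `t + p` of the system. -/
def groupedSeq : ℕ → ℤ × ℤ × ℤ
  | 0 => (0, 0, 0)
  | 1 => (0, 0, 0)
  | 2 => (0, 0, 0)
  | 3 => (0, 1, 0)
  | 4 => (1, 1, 0)
  | n + 5 =>
    ((groupedSeq (n + 4)).1 + (groupedSeq (n + 3)).2.1,
      (groupedSeq (n + 4)).2.1 + (groupedSeq (n + 4)).1 + (groupedSeq (n + 2)).1
        + (groupedSeq n).1 + (groupedSeq n).2.2 + (groupedSeq n).2.1
        + (if n = 1 then 1 else 0) + (if n = 3 then 1 else 0),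
      (groupedSeq (n + 3)).1 + (groupedSeq (n + 3)).2.2 + (groupedSeq (n + 3)).2.1
        + (if n = 0 then 1 else 0))

/-- The solution of the system. -/
def canonicalSeq : NineSeq where
  tri n := (groupedSeq (n - 1)).2.1 + if n = 3 then 1 else 0
  sq n := (groupedSeq (n - 1)).1
  ast n := (groupedSeq (n - 1)).1 + if n = 4 then 1 else 0
  dia n := (groupedSeq (n - 2)).2.1
  St1 n := (groupedSeq (n - 3)).1 + if n = 6 then 1 else 0
  St2 n := (groupedSeq (n - 5)).1 + (groupedSeq (n - 5)).2.2 + if n = 8 then 1 else 0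
  St n := (groupedSeq (n - 5)).2.1
  t n := (groupedSeq (n - 2)).1 + (groupedSeq (n - 2)).2.2 + if n = 5 then 1 else 0
  p n := (groupedSeq (n - 2)).2.1

theorem canonicalSeq_grouped (n : ℕ) (hn : 3 ≤ n) :
    canonicalSeq.ast n + canonicalSeq.dia n = (groupedSeq n).1 ∧
    canonicalSeq.tri n + canonicalSeq.sq n + canonicalSeq.St1 n + canonicalSeq.St2 n
      + canonicalSeq.St n = (groupedSeq n).2.1 ∧
    canonicalSeq.t n + canonicalSeq.p n = (groupedSeq n).2.2 := by
  match n, hn with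
  | 3, _ => decide
  | 4, _ => decide
  | n + 5, _ =>
    simp only [canonicalSeq, groupedSeq, show n + 5 - 1 = n + 4 by omega,
      show n + 5 - 2 = n + 3 by omega, show n + 5 - 3 = n + 2 by omega, Nat.add_sub_cancel,
      show (n + 5 = 3) = False by simp, show (n + 5 = 4) = False by simp,
      show (n + 5 = 6) = (n = 1) by simp, show (n + 5 = 8) = (n = 3) by simp,
      show (n + 5 = 5) = (n = 0) by simp, if_false]
    refine ⟨by ring, by ring, by ring⟩

/-- Since `groupedSeq` vanishes at 0, 1, 2, the shifted formulas also yield the initial zeros; the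
indicator at 3 supplies `tri 3 = 1`. -/
theorem canonicalSeq_solvesSystem : canonicalSeq.SolvesSystem where
  ast_rec n hn := by
    rw [(canonicalSeq_grouped (n - 1) (by omega)).1]; rfl
  tri_rec n hn := by
    rw [(canonicalSeq_grouped (n - 1) (by omega)).2.1]
    simp [canonicalSeq, show n ≠ 3 by omega]
  sq_rec n hn := by
    rw [(canonicalSeq_grouped (n - 1) (by omega)).1]; rfl
  dia_rec n hn := by
    rw [(canonicalSeq_grouped (n - 2) (by omega)).2.1]; rfl
  St1_rec n hn := by
    rw [(canonicalSeq_grouped (n - 3) (by omega)).1]; rfl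
  St2_rec n hn := by
    rw [add_assoc (canonicalSeq.ast _ + _) (canonicalSeq.t _),
      (canonicalSeq_grouped (n - 5) (by omega)).1, (canonicalSeq_grouped (n - 5) (by omega)).2.2]
    rfl
  St_rec n hn := by
    rw [(canonicalSeq_grouped (n - 5) (by omega)).2.1]; rfl
  t_rec n hn := by
    rw [add_assoc (canonicalSeq.ast _ + _) (canonicalSeq.t _),
      (canonicalSeq_grouped (n - 2) (by omega)).1, (canonicalSeq_grouped (n - 2) (by omega)).2.2]
    rfl
  p_rec n hn := by
    rw [(canonicalSeq_grouped (n - 2) (by omega)).2.1]; rfl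
  tri_init := by decide
  sq_init := by decide
  ast_init := by decide
  dia_init := by decide
  St1_init := by decide
  St2_init := by decide
  St_init := by decide
  t_init := by decide
  p_init := by decide

/-- Each right-hand side is determined by the three group sums at smaller indices, so strong
induction applies. -/
theorem NineSeq.SolvesSystem.agreeAt {s s' : NineSeq} (h : s.SolvesSystem)
    (h' : s'.SolvesSystem) (n : ℕ) (hn : 3 ≤ n) : s.AgreeAt s' n := by
  induction n using Nat.strong_induction_on with
  | _ n ih =>
    obtain ⟨a1, a2⟩ := h.dia_init
    obtain ⟨b1, b2, b3⟩ := h.St1_init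
    obtain ⟨c1, c2, c3, c4, c5⟩ := h.St2_init
    obtain ⟨d1, d2, d3, d4, d5⟩ := h.St_init
    obtain ⟨e1, e2⟩ := h.t_init
    obtain ⟨f1, f2⟩ := h.p_init
    obtain ⟨a1', a2'⟩ := h'.dia_init
    obtain ⟨b1', b2', b3'⟩ := h'.St1_init
    obtain ⟨c1', c2', c3', c4', c5'⟩ := h'.St2_init
    obtain ⟨d1', d2', d3', d4', d5'⟩ := h'.St_init
    obtain ⟨e1', e2'⟩ := h'.t_init
    obtain ⟨f1', f2'⟩ := h'.p_init
    have sums : ∀ m, 3 ≤ m → m < n →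
        s.ast m + s.dia m = s'.ast m + s'.dia m ∧
        s.tri m + s.sq m + s.St1 m + s.St2 m + s.St m
          = s'.tri m + s'.sq m + s'.St1 m + s'.St2 m + s'.St m ∧
        s.t m + s.p m = s'.t m + s'.p m := by
      intro m h3 hm
      obtain ⟨i1, i2, i3, i4, i5, i6, i7, i8, i9⟩ := ih m hm h3
      rw [i1, i2, i3, i4, i5, i6, i7, i8, i9]
      exact ⟨rfl, rfl, rfl⟩
    refine ⟨?_, ?_, ?_, ?_, ?_, ?_, ?_, ?_, ?_⟩
    · rcases hn.eq_or_lt with rfl | h4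
      · rw [h.tri_init, h'.tri_init]
      · rw [h.tri_rec n h4, h'.tri_rec n h4, (sums (n - 1) (by omega) (by omega)).2.1]
    · rcases hn.eq_or_lt with rfl | h4
      · rw [h.sq_init, h'.sq_init]
      · rw [h.sq_rec n h4, h'.sq_rec n h4, (sums (n - 1) (by omega) (by omega)).1]
    · rcases hn.eq_or_lt with rfl | h4
      · rw [h.ast_init, h'.ast_init]
      · rw [h.ast_rec n h4, h'.ast_rec n h4, (sums (n - 1) (by omega) (by omega)).1]
    · rcases lt_or_ge n 5 with h5 | h5
      · interval_cases n
        · rw [a1, a1']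
        · rw [a2, a2']
      · rw [h.dia_rec n h5, h'.dia_rec n h5, (sums (n - 2) (by omega) (by omega)).2.1]
    · rcases lt_or_ge n 6 with h6 | h6
      · interval_cases n
        · rw [b1, b1']
        · rw [b2, b2']
        · rw [b3, b3']
      · rw [h.St1_rec n h6, h'.St1_rec n h6, (sums (n - 3) (by omega) (by omega)).1]
    · rcases lt_or_ge n 8 with h8 | h8
      · interval_cases n
        · rw [c1, c1']
        · rw [c2, c2']
        · rw [c3, c3']
        · rw [c4, c4']
        · rw [c5, c5']
      · obtain ⟨i1, _, i3⟩ := sums (n - 5) (by omega) (by omega)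
        rw [h.St2_rec n h8, h'.St2_rec n h8]
        linarith
    · rcases lt_or_ge n 8 with h8 | h8
      · interval_cases n
        · rw [d1, d1']
        · rw [d2, d2']
        · rw [d3, d3']
        · rw [d4, d4']
        · rw [d5, d5']
      · rw [h.St_rec n h8, h'.St_rec n h8, (sums (n - 5) (by omega) (by omega)).2.1]
    · rcases lt_or_ge n 5 with h5 | h5
      · interval_cases n
        · rw [e1, e1']
        · rw [e2, e2']
      · obtain ⟨i1, _, i3⟩ := sums (n - 2) (by omega) (by omega)
        rw [h.t_rec n h5, h'.t_rec n h5]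
        linarith
    · rcases lt_or_ge n 5 with h5 | h5
      · interval_cases n
        · rw [f1, f1']
        · rw [f2, f2']
      · rw [h.p_rec n h5, h'.p_rec n h5, (sums (n - 2) (by omega) (by omega)).2.1]

theorem NineSeq.SolvesSystem.firstSeven_eq {s : NineSeq} (h : s.SolvesSystem) (n : ℕ)
    (hn : 3 ≤ n) : s.firstSeven n = (groupedSeq n).1 + (groupedSeq n).2.1 := by
  obtain ⟨i1, i2, i3, i4, i5, i6, i7, _, _⟩ := h.agreeAt canonicalSeq_solvesSystem n hn
  rw [NineSeq.firstSeven, i1, i2, i3, i4, i5, i6, i7, ← (canonicalSeq_grouped n hn).1,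
    ← (canonicalSeq_grouped n hn).2.1]
  ring

/-! ### A common recurrence of order 6 -/

/-- Starting at `w + 2` makes every index of `tailCount` at least `w + 3`, so both sides unfold to
linear forms in the values at `w`, `w + 1`, `w + 2`. Negative terms are moved across to stay in `ℕ`.
-/
theorem solutionCount_recurrence (w : ℕ) :
    solutionCount (w + 8) + solutionCount (w + 5) + solutionCount (w + 2)
      = 2 * solutionCount (w + 7) + solutionCount (w + 4) + solutionCount (w + 3) := by
  simp only [solutionCount, tailCount]
  omega

/-- The indicator terms act at index 8 at the latest, so from index 9 on the recursion is
homogeneous. -/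
theorem groupedSeq_step (n : ℕ) :
    (groupedSeq (n + 9)).1 = (groupedSeq (n + 8)).1 + (groupedSeq (n + 7)).2.1 ∧
    (groupedSeq (n + 9)).2.1 = (groupedSeq (n + 8)).2.1 + (groupedSeq (n + 8)).1
      + (groupedSeq (n + 6)).1 + (groupedSeq (n + 4)).1 + (groupedSeq (n + 4)).2.2
      + (groupedSeq (n + 4)).2.1 ∧
    (groupedSeq (n + 9)).2.2 = (groupedSeq (n + 7)).1 + (groupedSeq (n + 7)).2.2
      + (groupedSeq (n + 7)).2.1 := by
  rw [show n + 9 = n + 4 + 5 from rfl, groupedSeq]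
  simp

theorem add_recurrence_of_step {A T P : ℕ → ℤ}
    (h : ∀ n, A (n + 9) = A (n + 8) + T (n + 7) ∧
      T (n + 9) = T (n + 8) + A (n + 8) + A (n + 6) + A (n + 4) + P (n + 4) + T (n + 4) ∧
      P (n + 9) = A (n + 7) + P (n + 7) + T (n + 7)) (n : ℕ) :
    A (n + 16) + T (n + 16) = 2 * (A (n + 15) + T (n + 15)) - (A (n + 13) + T (n + 13))
      + (A (n + 12) + T (n + 12)) + (A (n + 11) + T (n + 11)) - (A (n + 10) + T (n + 10)) := by
  obtain ⟨-, -, p0⟩ := h n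
  obtain ⟨-, -, p1⟩ := h (n + 1)
  obtain ⟨a2, -, p2⟩ := h (n + 2)
  obtain ⟨-, t3, -⟩ := h (n + 3)
  obtain ⟨a4, t4, -⟩ := h (n + 4)
  obtain ⟨a5, -, -⟩ := h (n + 5)
  obtain ⟨-, t6, -⟩ := h (n + 6)
  obtain ⟨a7, t7, -⟩ := h (n + 7)
  simp only [add_assoc n, Nat.reduceAdd] at p0 p1 a2 p2 t3 a4 t4 a5 t6 a7 t7
  -- With `E` the shift and `g = E² - E + 1`, the equations for `A`, `T`, `P` are multiplied by
  -- `E²(E²-1)(E+1)g`, `E³(E²-1)g` and `g`; the factor `E² - 1` makes `P` cancel.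
  linear_combination a7 - a5 + a4 - a2 + t7 - t6 + t4 - t3 + p2 - p1 + p0

theorem solutionCount_eq (w : ℕ) :
    (solutionCount w : ℤ) = (groupedSeq (w + 3)).1 + (groupedSeq (w + 3)).2.1 := by
  induction w using Nat.strong_induction_on with
  | _ w ih =>
    rcases lt_or_ge w 13 with h | h
    -- The recurrence for `A + T` is available only from index 16 = 13 + 3 on, hence 13 initial
    -- values.
    · interval_cases w <;> decide
    · obtain ⟨m, rfl⟩ := Nat.exists_eq_add_of_le' h
      have r1 := solutionCount_recurrence (m + 5)
      have r2 := add_recurrence_of_step (A := fun n => (groupedSeq n).1)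
        (T := fun n => (groupedSeq n).2.1) (P := fun n => (groupedSeq n).2.2) groupedSeq_step m
      have i1 := ih (m + 12) (by omega)
      have i2 := ih (m + 10) (by omega)
      have i3 := ih (m + 9) (by omega)
      have i4 := ih (m + 8) (by omega)
      have i5 := ih (m + 7) (by omega)
      clear ih
      simp only [add_assoc m, Nat.reduceAdd] at r1 i1 i2 i3 i4 i5 r2 ⊢
      rw [r2, ← i1, ← i2, ← i3, ← i4, ← i5]
      omega

/-! ### The union over all odd primes -/

theorem five_mem_solU {n : ℕ} (hn : 4 ≤ n) : 5 ∈ solU n := by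
  have : (5 : ℕ) ∈ (Finset.Icc 1 (n - 3)).image (fun i => 5 ^ i) :=
    Finset.mem_image.2 ⟨1, by simp; omega, by norm_num⟩
  simp [solU, this]

theorem seven_mem_solV {n : ℕ} (hn : 5 ≤ n) : 7 ∈ solV n := by
  have : (7 : ℕ) ∈ (Finset.Icc 1 ((n - 3) / 2)).image (fun i => 7 ^ i) :=
    Finset.mem_image.2 ⟨1, by simp; omega, by norm_num⟩
  simp [solV, this]

theorem not_isTwoBounded {q r : ℕ} (hq : q.Prime) (hr : r.Prime) (ho : Odd r) (hne : r ≠ q) :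
    ¬ IsTwoBounded q r := by
  rintro ⟨α, β, _, h⟩
  rcases hr.dvd_mul.1 (dvd_of_eq h) with h2 | h2
  · have := (Nat.prime_dvd_prime_iff_eq hr Nat.prime_two).1 (hr.dvd_of_dvd_pow h2)
    subst this
    exact absurd ho (by decide)
  · exact hne ((Nat.prime_dvd_prime_iff_eq hr hq).1 (hr.dvd_of_dvd_pow h2))

theorem notMem_solutionsFor {n q r : ℕ} {X : Finset ℕ} (hq : q.Prime) (hr : r.Prime)
    (ho : Odd r) (hne : r ≠ q) (hX : r ∈ X) : X ∉ solutionsFor n q :=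
  fun h => not_isTwoBounded hq hr ho hne (h.2 r hX)

theorem allSolutions_eq {n : ℕ} (hn : 4 ≤ n) :
    allSolutions n = insert (solU n) (solutionsFor n 3 ∪ solutionsFor n 7) := by
  ext X
  rw [Set.mem_insert_iff, ← Set.mem_singleton_iff, ← solutionsFor_five hn, Set.mem_union]
  constructor
  · rintro ⟨q, hq, ho, hX⟩
    by_cases h5 : q = 5
    · subst h5; exact Or.inl hX
    by_cases h3 : q = 3
    · subst h3; exact Or.inr (Or.inl hX)
    by_cases h7 : q = 7
    · subst h7; exact Or.inr (Or.inr hX)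
    rw [solutionsFor_of_ne (by omega) hq ho h3 h5 h7] at hX
    exact absurd hX (Set.notMem_empty _)
  · rintro (h | h | h)
    · exact ⟨5, by norm_num, by decide, h⟩
    · exact ⟨3, by norm_num, by decide, h⟩
    · exact ⟨7, by norm_num, by decide, h⟩

theorem ncard_allSolutions {n : ℕ} (hn : 4 ≤ n) (h3 : (solutionsFor n 3).Finite)
    (h7 : (solutionsFor n 7).Finite) :
    (allSolutions n).ncard = (solutionsFor n 3 ∪ solutionsFor n 7).ncard + 1 := by
  rw [allSolutions_eq hn, Set.ncard_insert_of_notMem _ (h3.union h7)]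
  rintro (h | h)
  · exact notMem_solutionsFor (by norm_num) (by norm_num) (by decide) (by norm_num)
      (five_mem_solU hn) h
  · exact notMem_solutionsFor (by norm_num) (by norm_num) (by decide) (by norm_num)
      (five_mem_solU hn) h

theorem finite_solutionsFor_three (w : ℕ) : (solutionsFor (w + 3) 3).Finite :=
  Set.finite_of_encard_eq_coe (encard_solutionsFor_three w)

theorem NineSeq.SolvesSystem.ncard_solutionsFor_three {s : NineSeq} (h : s.SolvesSystem)
    (w : ℕ) : ((solutionsFor (w + 3) 3).ncard : ℤ) = s.firstSeven (w + 3) := by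
  rw [h.firstSeven_eq _ (by omega), ← solutionCount_eq, Set.ncard, encard_solutionsFor_three]
  simp

theorem theorem2 :
    (∃ s : NineSeq, s.SolvesSystem) ∧
    (∀ s s' : NineSeq, s.SolvesSystem → s'.SolvesSystem → ∀ n, 3 ≤ n → s.AgreeAt s' n) ∧
    ∀ s : NineSeq, s.SolvesSystem → ∀ n : ℕ, 9 ≤ n →
      ((solutionsFor n 3).Finite ∧ ((solutionsFor n 3).ncard : ℤ) = s.firstSeven n) ∧
      solutionsFor n 5 = {solU n} ∧
      (Odd n → solutionsFor n 7 = {solV n}) ∧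
      (Even n → solutionsFor n 7 = ∅) ∧
      (∀ q : ℕ, q.Prime → Odd q → q ≠ 3 → q ≠ 5 → q ≠ 7 → solutionsFor n q = ∅) ∧
      (allSolutions n).Finite ∧
      (Odd n → ((allSolutions n).ncard : ℤ) = s.firstSeven n + 2) ∧
      (Even n → ((allSolutions n).ncard : ℤ) = s.firstSeven n + 1) := by
  refine ⟨⟨canonicalSeq, canonicalSeq_solvesSystem⟩, fun s s' h h' => h.agreeAt h',
    fun s h n hn => ?_⟩
  have hfin : (solutionsFor n 3).Finite := by
    obtain ⟨w, rfl⟩ := Nat.exists_eq_add_of_le' (show 3 ≤ n by omega)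
    exact finite_solutionsFor_three w
  have hcard : ((solutionsFor n 3).ncard : ℤ) = s.firstSeven n := by
    obtain ⟨w, rfl⟩ := Nat.exists_eq_add_of_le' (show 3 ≤ n by omega)
    exact h.ncard_solutionsFor_three w
  have hodd : Odd n → solutionsFor n 7 = {solV n} := solutionsFor_seven_odd (by omega)
  have heven : Even n → solutionsFor n 7 = ∅ := solutionsFor_seven_even (by omega)
  have hfin7 : (solutionsFor n 7).Finite := by
    rcases Nat.even_or_odd n with he | ho
    · rw [heven he]; exact Set.finite_empty
    · rw [hodd ho]; exact Set.finite_singleton _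
  refine ⟨⟨hfin, hcard⟩, solutionsFor_five (by omega), hodd, heven,
    fun q hq ho h3 h5 h7 => solutionsFor_of_ne (by omega) hq ho h3 h5 h7, ?_, fun ho => ?_,
    fun he => ?_⟩
  · rw [allSolutions_eq (by omega)]
    exact (hfin.union hfin7).insert _
  · have hV : solV n ∉ solutionsFor n 3 := notMem_solutionsFor (by norm_num)
      (show Nat.Prime 7 by norm_num) (by decide) (by norm_num) (seven_mem_solV (by omega))
    rw [ncard_allSolutions (by omega) hfin hfin7, hodd ho, Set.union_singleton,
      Set.ncard_insert_of_notMem hV hfin, ← hcard]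
    push_cast
    ring
  · rw [ncard_allSolutions (by omega) hfin hfin7, heven he, Set.union_empty, ← hcard]
    push_cast
    ring
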